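/- Graphs are finite and simple. Let $m(G)$ be the number of edges of $G$, and let $\nu_s(G)$ be the strong matching number of $G$: the maximum size of a set $M$ of edges of $G$ such that no two distinct edges in $M$ have a common endvertex and no edge of $G$ joins two distinct edges in $M$ (an induced matching). Let $C_5^2$ be the graph obtained from the $5$-cycle by replacing every vertex by an independent set of order $2$, vertices of different sets being adjacent exactly if the corresponding vertices of the $5$-cycle are adjacent. Every graph $G$ with maximum degree at most $4$ satisfies $$\nu_s(G)\geq \frac{m(G)}{20}.$$ If, moreover, no connected component of $G$ is isomorphic to $C_5^2$, then $$\nu_s(G)\geq \frac{m(G)}{18}.$$ -/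

import Mathlib

namespace StrongMatching

/-- A set `M` of edges of `G` is an induced matching if no two distinct edges in `M` have a
common endvertex and no edge of `G` joins two distinct edges in `M`. -/
def IsInducedMatching {V : Type*} (G : SimpleGraph V) (M : Finset (Sym2 V)) : Prop :=
  (∀ e ∈ M, e ∈ G.edgeSet) ∧
    ∀ e ∈ M, ∀ f ∈ M, e ≠ f → ∀ u ∈ e, ∀ v ∈ f, u ≠ v ∧ ¬ G.Adj u v

/-- The strong matching number `ν_s(G)`: the maximum number of edges that form an induced
matching in `G`. -/
noncomputable def strongMatchingNumber {V : Type*} (G : SimpleGraph V) : ℕ :=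
  sSup {k : ℕ | ∃ M : Finset (Sym2 V), IsInducedMatching G M ∧ M.card = k}

/-- In a finite graph the supremum above is an attained maximum. -/
theorem strongMatchingNumber_isGreatest {V : Type*} [Finite V] (G : SimpleGraph V) :
    IsGreatest {k : ℕ | ∃ M : Finset (Sym2 V), IsInducedMatching G M ∧ M.card = k}
      (strongMatchingNumber G) := by
  classical
  have := Fintype.ofFinite V
  have hne : {k : ℕ | ∃ M : Finset (Sym2 V), IsInducedMatching G M ∧ M.card = k}.Nonempty :=
    ⟨0, ∅, by simp [IsInducedMatching], rfl⟩
  have hbdd : BddAbove {k : ℕ | ∃ M : Finset (Sym2 V), IsInducedMatching G M ∧ M.card = k} :=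
    ⟨Fintype.card (Sym2 V), by rintro k ⟨M, -, rfl⟩; exact Finset.card_le_univ M⟩
  exact ⟨Nat.sSup_mem hne hbdd, fun k hk => le_csSup hbdd hk⟩

/-- The graph `C_5^2`: the 5-cycle with every vertex replaced by an independent set of order 2
(vertices are adjacent exactly if the vertices of the 5-cycle they replace are). -/
def blownUpFiveCycle : SimpleGraph (Fin 5 × Fin 2) :=
  (SimpleGraph.cycleGraph 5).comap Prod.fst

/-- `G` has a connected component that is isomorphic to `C_5^2`. -/
def HasBlownUpFiveCycleComponent {V : Type*} (G : SimpleGraph V) : Prop :=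
  ∃ c : G.ConnectedComponent, Nonempty (c.toSimpleGraph ≃g blownUpFiveCycle)

end StrongMatching

/-!
Both bounds follow from a local statement (`exists_ncard_shadow_le`). The *shadow* of an edge `uv`
consists of the vertices in `N(u) ∪ N(v)` and of those vertices of positive degree that become
isolated when `N(u) ∪ N(v)` is deleted. If `G` has maximum degree at most 4, at least one edge, and
no copy of `C_5^2`, then some edge has a shadow of at most nine vertices. Deleting
`N(u) ∪ N(v)` for such an edge lowers the strong matching number by at least one and the number of
vertices of positive degree by at most nine. Hence there are at most `9 ν_s` vertices of positive
degree, and at most twice as many edges (`ncard_edgeSet_le_of_free`). A copy of `C_5^2` is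
4-regular and connected, so it is a component. It contributes 20 edges and contains an edge whose
neighbourhood lies in the component, so removing the copies one at a time gives `m ≤ 20 ν_s`
(`ncard_edgeSet_le_twenty_mul`).

The local statement is proved by a finite search. Suppose that all shadows have at least ten
vertices, and start at a vertex of minimum positive degree `δ`. A state of the search is a graph on
`k` named vertices, some of which are *closed*: all their neighbours are named. If `u` and `v` are
adjacent closed vertices and fewer than ten vertices of the shadow of `uv` are known, then there is
another vertex, old or new, whose neighbourhood is contained in the known set `N(u) ∪ N(v)`, which
leaves few possibilities. If there is no such edge, the neighbourhood of the first open vertex is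
guessed. Open vertices with the same known neighbours are interchangeable, so only one
representative of each choice is followed. For every `δ ≤ 4` all branches end in a
contradiction, except for one that ends in `C_5^2`.

The search is the function `refute`, evaluated by the kernel in `refute_star`. Its soundness is
`not_realizes_of_refute`: no state that it refutes is realized in a graph in which all shadows are
large. The predicate `Realizes` says that a state describes a part of `G`, and
`Realizes.exists_growVertex` and `Realizes.exists_growShadow` say that the branches considered are
exhaustive.
-/

namespace StrongMatching

/-! ### The search program -/

/-- The binary digit of `m` in position `i`. -/
def bit (m i : ℕ) : Bool := Nat.beq ((m >>> i) % 2) 1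

/-- Whether `E`, read as the code of a graph on at most 32 vertices, contains the edge `ij`:
row `i` of the adjacency matrix is stored in the digits `32 i, …, 32 i + 31` of `E`. -/
def edge (E i j : ℕ) : Bool := bit E (32 * i + j)

/-- Row `i` of the adjacency matrix coded by `E`, as a bit mask. -/
def row (E i : ℕ) : ℕ := (E >>> (32 * i)) % 2 ^ 32

/-- Insert the edge `ij`. -/
def link (E i j : ℕ) : ℕ := E ||| 2 ^ (32 * i + j) ||| 2 ^ (32 * j + i)

/-- Insert all edges from `v` to the vertices in `T`. -/
def linkAll (E v : ℕ) (T : List ℕ) : ℕ := T.foldl (fun E t => link E v t) E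

/-- The vertices below `k` that `E` joins to `i`. -/
def nbrs (k E i : ℕ) : List ℕ := (List.range k).filter (edge E i)

/-- The bit mask `a` is contained in the bit mask `b`. -/
def within (a b : ℕ) : Bool := Nat.beq (a &&& b) a

/-- The sublists of `l` of length at most `m` up to exchanging vertices with the same row: of the
vertices that share a row only initial segments are chosen. A vertex whose row is in `skip` is not
chosen. -/
def choices (E : ℕ) (l : List ℕ) : ℕ → List ℕ → List (List ℕ) :=
  List.rec (fun _ _ => [[]]) (fun x _ ih m skip =>
    Nat.rec [[]] (fun m' _ =>
      bif skip.any (Nat.beq (row E x)) then ih (m' + 1) skip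
      else (ih m' skip).map (x :: ·) ++ ih (m' + 1) (row E x :: skip)) m) l

/-- Add to the mask `c` of closed vertices those vertices of `T` that already have four
neighbours. -/
def saturate (k E c : ℕ) (T : List ℕ) : ℕ :=
  T.foldl (fun c i => bif Nat.ble 4 (nbrs k E i).length then c ||| 2 ^ i else c) c

/-- The mask of the known neighbours of `u` and `v`. -/
def span (E u v : ℕ) : ℕ := row E u ||| row E v

/-- The vertex `j` lies in `a`, or it is closed and all its neighbours lie in `a`. -/
def caught (E c a j : ℕ) : Bool := bit a j || (bit c j && within (row E j) a)

/-- `uv` is an edge for which at most nine vertices of the shadow are known. -/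
def deficient (k E c u v : ℕ) : Bool :=
  edge E u v && Nat.ble ((List.range k).filter (caught E c (span E u v))).length 9

/-- The ways to close the vertex `v`. An entry `(k', v, T)` stands for the new number `k'` of
vertices and the list `T` of new neighbours of `v`. -/
def growVertex (δ k E c v : ℕ) : List (ℕ × ℕ × List ℕ) :=
  (choices E ((List.range k).filter fun j => !(bit c j || edge E v j || Nat.beq j v))
    (4 - (nbrs k E v).length) []).flatMap fun S =>
    ((List.range 5).filter fun r => Nat.ble δ ((nbrs k E v).length + S.length + r) &&
      Nat.ble ((nbrs k E v).length + S.length + r) 4).map fun r => (k + r, v, S ++ List.range' k r)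

/-- The old or new vertices `w` outside of the mask `a` that may become closed with all
neighbours in `a`; of several vertices with the same row only the first one is listed. -/
def candidates (k E c a : ℕ) : List ℕ :=
  (List.range (k + 1)).filter fun w => Nat.beq w k || (!(bit a w || bit c w) &&
    within (row E w) a && (List.range w).all fun i => bit c i || !Nat.beq (row E i) (row E w))

/-- The ways to exhibit one more vertex `w` outside of the mask `a` all of whose neighbours lie
in `a`, in the format of `growVertex`. -/
def growShadow (δ k E c a : ℕ) : List (ℕ × ℕ × List ℕ) :=
  (candidates k E c a).flatMap fun w =>
    ((choices E ((List.range k).filter fun j => bit a j && !(bit c j || edge E w j))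
      (4 - (nbrs k E w).length) []).filter fun S =>
        Nat.ble δ ((nbrs k E w).length + S.length)).map fun S => (max k (w + 1), w, S)

/-- A deficient edge between closed vertices, if there is one. -/
def pick (k E c : ℕ) : Option (ℕ × ℕ) :=
  ((List.range k).reverse.filter (bit c)).findSome? fun u =>
    (((List.range k).reverse.filter (bit c)).find? (deficient k E c u)).map (u, ·)

/-- The labels of the vertices of `C_5^2` in the only closed graph that the search meets: the
vertices that replace vertex `a` of the 5-cycle have the labels in positions `2 a` and
`2 a + 1`. -/
def blowUpLabels : List ℕ := [0, 7, 1, 4, 5, 6, 8, 9, 2, 3]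

/-- `E` contains the copy of `C_5^2` described by `blowUpLabels`. -/
def isBlowUp (k E : ℕ) : Bool :=
  Nat.ble 10 k && (List.range 5).all fun a => (List.range 2).all fun s =>
    (List.range 2).all fun t => edge E (blowUpLabels.getD (2 * a + s) 0)
      (blowUpLabels.getD (2 * ((a + 1) % 5) + t) 0)

/-- The case distinction made at a given state, or `none` if there is nothing to distinguish. -/
def branches (δ k E c : ℕ) : Option (List (ℕ × ℕ × List ℕ)) :=
  match pick k E c with
  | some p => some (growShadow δ k E c (span E p.1 p.2))
  | none => ((List.range k).find? fun v => !bit c v).map (growVertex δ k E c)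

/-- Search through all extensions of the graph with `k` vertices, edges `E` and closed vertices
`c`, with `n` bounding the depth. The value `true` means that every branch ends in a contradiction
or in a copy of `C_5^2`. A step names at most four vertices, so the bound `k ≤ 28` keeps all labels
below 32, the length of a row. -/
def refute (δ n : ℕ) : ℕ → ℕ → ℕ → Bool :=
  Nat.rec (fun _ _ _ => false) (fun _ ih k E c =>
    Nat.ble k 28 && Option.rec (isBlowUp k E) (fun l => l.all fun b =>
      ih b.1 (linkAll E b.2.1 b.2.2)
        (saturate b.1 (linkAll E b.2.1 b.2.2) (c ||| 2 ^ b.2.1) b.2.2)) (branches δ k E c)) n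

/-- The code of the star with centre `0` and `δ` leaves. -/
def star (δ : ℕ) : ℕ := linkAll 0 0 (List.range' 1 δ)

/-! ### The outcome of the search -/

theorem refute_star_one : refute 1 20 2 (star 1) 1 = true := by decide +kernel

theorem refute_star_two : refute 2 20 3 (star 2) 1 = true := by decide +kernel

theorem refute_star_three : refute 3 20 4 (star 3) 1 = true := by decide +kernel

theorem refute_star_four : refute 4 20 5 (star 4) 1 = true := by decide +kernel

/-- The search succeeds when started from a star with at most four leaves whose centre is
closed. -/
theorem refute_star {δ : ℕ} (h0 : 0 < δ) (h4 : δ ≤ 4) :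
    refute δ 20 (1 + δ) (star δ) 1 = true := by
  obtain rfl | rfl | rfl | rfl : δ = 1 ∨ δ = 2 ∨ δ = 3 ∨ δ = 4 := by omega
  exacts [refute_star_one, refute_star_two, refute_star_three, refute_star_four]

/-! ### Reading and writing codes -/

theorem bit_eq_testBit (m i : ℕ) : bit m i = m.testBit i := by
  rw [bit, Nat.testBit_eq_decide_div_mod_eq, Nat.shiftRight_eq_div_pow]
  rw [Bool.eq_iff_iff, Nat.beq_eq, decide_eq_true_iff]

theorem bit_or_two_pow (c v i : ℕ) : bit (c ||| 2 ^ v) i = true ↔ bit c i = true ∨ i = v := by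
  rw [bit_eq_testBit, bit_eq_testBit, Nat.testBit_or, Nat.testBit_two_pow, Bool.or_eq_true,
    decide_eq_true_iff, eq_comm (a := v)]

theorem testBit_row (E i j : ℕ) : (row E i).testBit j = (decide (j < 32) && edge E i j) := by
  rw [row, edge, bit_eq_testBit, Nat.testBit_mod_two_pow, Nat.testBit_shiftRight]

theorem edge_eq_of_row_eq {E i j : ℕ} (h : row E i = row E j) {x : ℕ} (hx : x < 32) :
    edge E i x = edge E j x := by
  have := congrArg (fun r => r.testBit x) h
  simpa [testBit_row, hx] using this

theorem within_iff (a b : ℕ) :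
    within a b = true ↔ ∀ j, a.testBit j = true → b.testBit j = true := by
  rw [within, Nat.beq_eq]
  constructor
  · intro h j hj
    rw [← h, Nat.testBit_and] at hj
    simp_all
  · intro h
    refine Nat.eq_of_testBit_eq fun j => ?_
    rw [Nat.testBit_and]
    have := h j
    cases ha : a.testBit j <;> simp_all

theorem bit_span {E u v j : ℕ} (hj : j < 32) :
    bit (span E u v) j = true ↔ edge E u j = true ∨ edge E v j = true := by
  simp [bit_eq_testBit, span, Nat.testBit_or, testBit_row, hj]

theorem edge_link {E i j a b : ℕ} (hi : i < 32) (hj : j < 32) (hb : b < 32) :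
    edge (link E i j) a b = true ↔ edge E a b = true ∨ (a = i ∧ b = j) ∨ (a = j ∧ b = i) := by
  simp only [edge, link, bit_eq_testBit, Nat.testBit_or, Nat.testBit_two_pow, Bool.or_eq_true,
    decide_eq_true_eq]
  rw [or_assoc]
  refine or_congr Iff.rfl (or_congr ?_ ?_) <;> omega

theorem edge_linkAll {v a b : ℕ} (hv : v < 32) (hb : b < 32) (T : List ℕ)
    (hT : ∀ t ∈ T, t < 32) (E : ℕ) : edge (linkAll E v T) a b = true ↔
      edge E a b = true ∨ (a = v ∧ b ∈ T) ∨ (b = v ∧ a ∈ T) := by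
  induction T generalizing E with
  | nil => simp [linkAll]
  | cons t T ih =>
    have := ih (fun t ht => hT t (by simp [ht])) (link E v t)
    rw [linkAll, List.foldl_cons, ← linkAll, this,
      edge_link hv (hT t (by simp)) hb]
    simp only [List.mem_cons]
    tauto

theorem mem_nbrs {k E i j : ℕ} : j ∈ nbrs k E i ↔ j < k ∧ edge E i j = true := by
  simp [nbrs]

theorem nodup_nbrs (k E i : ℕ) : (nbrs k E i).Nodup := List.nodup_range.filter _

/-- A family that chooses an initial segment among vertices with the same row is found by
`choices`. -/
theorem filter_mem_choices (E : ℕ) (P : ℕ → Prop) [DecidablePred P] (l : List ℕ) :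
    ∀ (m : ℕ) (skip : List ℕ), (l.filter fun x => decide (P x)).length ≤ m →
      (∀ x ∈ l, P x → row E x ∉ skip) →
      (l.Pairwise fun i j => row E i = row E j → P j → P i) →
      (l.filter fun x => decide (P x)) ∈ choices E l m skip := by
  induction l with
  | nil => intro m skip _ _ _; simp [choices]
  | cons x l ih =>
    intro m skip hm hskip hP
    obtain ⟨hx, hl⟩ := List.pairwise_cons.1 hP
    cases m with
    | zero =>
      rw [List.length_eq_zero_iff.1 (Nat.le_zero.1 hm)]
      exact List.mem_singleton.2 rfl
    | succ m =>
      change _ ∈ bif skip.any (Nat.beq (row E x)) then choices E l (m + 1) skip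
        else (choices E l m skip).map (x :: ·) ++ choices E l (m + 1) (row E x :: skip)
      have hany : skip.any (Nat.beq (row E x)) = true ↔ row E x ∈ skip := by
        simp [List.any_eq_true, Nat.beq_eq]
      by_cases hs : row E x ∈ skip
      · have hPx : ¬ P x := fun h => hskip x (by simp) h hs
        rw [hany.2 hs, cond_true]
        simp only [List.filter_cons, hPx, decide_false, Bool.false_eq_true, if_false] at hm ⊢
        exact ih _ _ hm (fun y hy => hskip y (by simp [hy])) hl
      · rw [Bool.eq_false_iff.2 (fun h => hs (hany.1 h)), cond_false, List.mem_append]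
        by_cases hPx : P x
        · left
          simp only [List.filter_cons, hPx, decide_true, if_true, List.length_cons] at hm ⊢
          exact List.mem_map_of_mem
            (ih _ _ (by omega) (fun y hy => hskip y (by simp [hy])) hl)
        · right
          simp only [List.filter_cons, hPx, decide_false, Bool.false_eq_true, if_false] at hm ⊢
          refine ih _ _ hm (fun y hy hPy => ?_) hl
          rw [List.mem_cons, not_or]
          exact ⟨fun h => hPx (hx y hy h.symm hPy), hskip y (by simp [hy]) hPy⟩

/-! ### States realized in a graph -/

section Realizes

variable {V : Type*} [Fintype V] {G : SimpleGraph V} [DecidableRel G.Adj]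
  {δ k E c : ℕ} {f : ℕ → V}

/-- The vertices `f 0, …, f (k - 1)` of `G` are distinct, of degree at least `δ`, and joined by
the edges coded by `E`, and every neighbour of a vertex marked in `c` is one of them and joined to
it in `E`. -/
structure Realizes (G : SimpleGraph V) [DecidableRel G.Adj] (δ k E c : ℕ) (f : ℕ → V) : Prop where
  le : k ≤ 32
  inj : ∀ i < k, ∀ j < k, f i = f j → i = j
  deg : ∀ i < k, δ ≤ G.degree (f i)
  adj : ∀ i < 32, ∀ j < 32, edge E i j = true →
    i < k ∧ j < k ∧ edge E j i = true ∧ G.Adj (f i) (f j)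
  closed : ∀ i, bit c i = true →
    i < k ∧ ∀ x, G.Adj (f i) x → ∃ j < k, edge E i j = true ∧ f j = x

theorem Realizes.edge_comm (h : Realizes G δ k E c f) {i j : ℕ} (hi : i < 32) (hj : j < 32) :
    edge E i j = edge E j i :=
  Bool.eq_iff_iff.2 ⟨fun e => (h.adj i hi j hj e).2.2.1, fun e => (h.adj j hj i hi e).2.2.1⟩

theorem Realizes.edge_of_adj (h : Realizes G δ k E c f) {i j : ℕ} (hi : bit c i = true)
    (hj : j < k) (hadj : G.Adj (f i) (f j)) : edge E i j = true := by
  obtain ⟨j', hj', he, hf⟩ := (h.closed i hi).2 _ hadj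
  rwa [← h.inj j' hj' j hj hf]

/-- The degree of `f i`, counted through any complete duplicate-free list of its neighbours. -/
theorem Realizes.degree_eq (h : Realizes G δ k E c f) {i : ℕ} (L : List ℕ) (hL : L.Nodup)
    (hk : ∀ j ∈ L, j < k) (hadj : ∀ j ∈ L, G.Adj (f i) (f j))
    (hall : ∀ x, G.Adj (f i) x → ∃ j ∈ L, f j = x) : G.degree (f i) = L.length := by
  classical
  have : G.neighborFinset (f i) = (L.map f).toFinset := by
    ext x
    simp only [SimpleGraph.mem_neighborFinset, List.mem_toFinset, List.mem_map]
    exact ⟨hall x, fun ⟨j, hj, hx⟩ => hx ▸ hadj j hj⟩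
  rw [← SimpleGraph.card_neighborFinset_eq_degree, this, List.toFinset_card_of_nodup,
    List.length_map]
  exact hL.map_on fun a ha b hb => h.inj a (hk a ha) b (hk b hb)

/-- Known neighbours bound the degree of `f i` from below, and they are all the neighbours if their
number is not smaller than the degree. -/
theorem Realizes.degree_ge (h : Realizes G δ k E c f) {i : ℕ} (L : List ℕ) (hL : L.Nodup)
    (hk : ∀ j ∈ L, j < k) (hadj : ∀ j ∈ L, G.Adj (f i) (f j)) :
    L.length ≤ G.degree (f i) ∧
      (G.degree (f i) ≤ L.length → ∀ x, G.Adj (f i) x → ∃ j ∈ L, f j = x) := by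
  classical
  have hsub : (L.map f).toFinset ⊆ G.neighborFinset (f i) := by
    intro x
    simp only [SimpleGraph.mem_neighborFinset, List.mem_toFinset, List.mem_map]
    exact fun ⟨j, hj, hx⟩ => hx ▸ hadj j hj
  have hcard : (L.map f).toFinset.card = L.length := by
    rw [List.toFinset_card_of_nodup, List.length_map]
    exact hL.map_on fun a ha b hb => h.inj a (hk a ha) b (hk b hb)
  rw [← SimpleGraph.card_neighborFinset_eq_degree]
  refine ⟨hcard ▸ Finset.card_le_card hsub, fun hle x hx => ?_⟩
  have := Finset.eq_of_subset_of_card_le hsub (hcard ▸ hle)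
  rw [← SimpleGraph.mem_neighborFinset, ← this] at hx
  simpa using hx

theorem Realizes.adj_of_mem_nbrs (h : Realizes G δ k E c f) {i j l : ℕ} (hi : i < 32) (hl : l ≤ 32)
    (hj : j ∈ nbrs l E i) : j < k ∧ G.Adj (f i) (f j) := by
  rw [mem_nbrs] at hj
  obtain ⟨-, h1, -, h2⟩ := h.adj i hi j (by omega) hj.2
  exact ⟨h1, h2⟩

theorem Realizes.saturate (h : Realizes G δ k E c f) (h4 : ∀ x, G.degree x ≤ 4) (T : List ℕ)
    (hT : ∀ t ∈ T, t < k) : Realizes G δ k E (saturate k E c T) f := by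
  induction T generalizing c with
  | nil => exact h
  | cons t T ih =>
    rw [StrongMatching.saturate, List.foldl_cons, ← StrongMatching.saturate]
    refine ih ?_ fun t ht => hT t (by simp [ht])
    cases hb : Nat.ble 4 (nbrs k E t).length with
    | false => exact h
    | true =>
      rw [Nat.ble_eq] at hb
      refine ⟨h.le, h.inj, h.deg, h.adj, fun i hi => ?_⟩
      rw [cond_true, bit_or_two_pow] at hi
      obtain hi | rfl := hi
      · exact h.closed i hi
      · have htk := hT i (by simp)
        have := h.le
        refine ⟨htk, fun x hx => ?_⟩
        obtain ⟨j, hj, hjx⟩ := (h.degree_ge (i := i) (nbrs k E i) (nodup_nbrs _ _ _)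
          (fun j hj => (h.adj_of_mem_nbrs (by omega) h.le hj).1)
          (fun j hj => (h.adj_of_mem_nbrs (by omega) h.le hj).2)).2 ((h4 _).trans hb) x hx
        exact ⟨j, (mem_nbrs.1 hj).1, (mem_nbrs.1 hj).2, hjx⟩

/-- Name further vertices. -/
theorem Realizes.extend (h : Realizes G δ k E c f) (L : List V) (hL : L.Nodup)
    (hdisj : ∀ i < k, f i ∉ L) (hdeg : ∀ x ∈ L, δ ≤ G.degree x) (hk : k + L.length ≤ 32) :
    ∃ f', Realizes G δ (k + L.length) E c f' ∧ (∀ i < k, f' i = f i) ∧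
      ∀ i (hi : i < L.length), f' (k + i) = L[i] := by
  refine ⟨fun i => if i < k then f i else L.getD (i - k) (f i), ?_, ?_, ?_⟩
  · have hlow : ∀ i < k, (if i < k then f i else L.getD (i - k) (f i)) = f i :=
      fun i hi => if_pos hi
    have hhigh : ∀ i, (h' : ¬ i < k) → ∀ hi : i < k + L.length,
        (if i < k then f i else L.getD (i - k) (f i)) = L[i - k]'(by omega) := by
      intro i hi hi'
      rw [if_neg hi, List.getD_eq_getElem]
    refine ⟨hk, fun i hi j hj hij => ?_, fun i hi => ?_, fun i hi j hj he => ?_, fun i hi => ?_⟩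
    · by_cases h1 : i < k <;> by_cases h2 : j < k
      · rw [hlow i h1, hlow j h2] at hij
        exact h.inj i h1 j h2 hij
      · rw [hlow i h1, hhigh j h2 hj] at hij
        exact absurd (hij ▸ List.getElem_mem _) (hdisj i h1)
      · rw [hlow j h2, hhigh i h1 hi] at hij
        exact absurd (hij ▸ List.getElem_mem _) (hdisj j h2)
      · rw [hhigh i h1 hi, hhigh j h2 hj, hL.getElem_inj_iff] at hij
        omega
    · by_cases h1 : i < k
      · rw [hlow i h1]; exact h.deg i h1
      · rw [hhigh i h1 hi]; exact hdeg _ (List.getElem_mem _)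
    · obtain ⟨h1, h2, h3, h4⟩ := h.adj i hi j hj he
      rw [hlow i h1, hlow j h2]
      exact ⟨by omega, by omega, h3, h4⟩
    · obtain ⟨h1, h2⟩ := h.closed i hi
      refine ⟨by omega, fun x hx => ?_⟩
      rw [hlow i h1] at hx
      obtain ⟨j, hj, he, hf⟩ := h2 x hx
      exact ⟨j, by omega, he, by rw [hlow j hj, hf]⟩
  · intro i hi
    exact if_pos hi
  · intro i hi
    simp [hi]

/-- Record the edges from `w` to the vertices in `T`, after which `w` is closed. -/
theorem Realizes.close (h : Realizes G δ k E c f) {w : ℕ} (hw : w < k) (T : List ℕ)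
    (hT : ∀ t ∈ T, t < k ∧ G.Adj (f w) (f t))
    (hall : ∀ x, G.Adj (f w) x → ∃ j < k, (edge E w j = true ∨ j ∈ T) ∧ f j = x) :
    Realizes G δ k (linkAll E w T) (c ||| 2 ^ w) f := by
  have hk := h.le
  have key : ∀ {a b : ℕ}, b < 32 → (edge (linkAll E w T) a b = true ↔
      edge E a b = true ∨ (a = w ∧ b ∈ T) ∨ (b = w ∧ a ∈ T)) := fun hb =>
    edge_linkAll (by omega) hb T (fun t ht => by have := (hT t ht).1; omega) E
  refine ⟨h.le, h.inj, h.deg, fun i hi j hj he => ?_, fun i hi => ?_⟩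
  · rw [key hi]
    rw [key hj] at he
    obtain he | ⟨rfl, he⟩ | ⟨rfl, he⟩ := he
    · obtain ⟨h1, h2, h3, h4⟩ := h.adj i hi j hj he
      exact ⟨h1, h2, Or.inl h3, h4⟩
    · exact ⟨hw, (hT j he).1, by tauto, (hT j he).2⟩
    · exact ⟨(hT i he).1, hw, by tauto, (hT i he).2.symm⟩
  · rw [bit_or_two_pow] at hi
    obtain hi | rfl := hi
    · obtain ⟨h1, h2⟩ := h.closed i hi
      refine ⟨h1, fun x hx => ?_⟩
      obtain ⟨j, hj, he, hf⟩ := h2 x hx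
      exact ⟨j, hj, (key (by omega)).2 (Or.inl he), hf⟩
    · refine ⟨hw, fun x hx => ?_⟩
      obtain ⟨j, hj, he, hf⟩ := hall x hx
      refine ⟨j, hj, (key (by omega)).2 ?_, hf⟩
      tauto

/-- Exchanging the names of two vertices with the same row. -/
theorem Realizes.swap (h : Realizes G δ k E c f) {i j : ℕ} (hi : i < k) (hj : j < k)
    (hci : bit c i = false) (hcj : bit c j = false) (hrow : row E i = row E j) :
    Realizes G δ k E c (f ∘ Equiv.swap i j) := by
  have hk := h.le
  have hlt : ∀ {a : ℕ}, a < k → Equiv.swap i j a < k := by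
    intro a ha
    rw [Equiv.swap_apply_def]; split_ifs <;> assumption
  have hE : ∀ {a b : ℕ}, b < 32 → edge E (Equiv.swap i j a) b = edge E a b := by
    intro a b hb
    rw [Equiv.swap_apply_def]
    split_ifs with h1 h2
    · rw [h1]; exact (edge_eq_of_row_eq hrow hb).symm
    · rw [h2]; exact edge_eq_of_row_eq hrow hb
    · rfl
  have hE2 : ∀ {a b : ℕ}, a < k → b < k →
      edge E (Equiv.swap i j a) (Equiv.swap i j b) = edge E a b := by
    intro a b ha hb
    have := hlt hb
    rw [hE (by omega), h.edge_comm (by omega) (by omega), hE (by omega),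
      h.edge_comm (by omega) (by omega)]
  refine ⟨h.le, fun a ha b hb hab => ?_, fun a ha => h.deg _ (hlt ha), fun a ha b hb he => ?_,
    fun a ha => ?_⟩
  · exact (Equiv.swap i j).injective (h.inj _ (hlt ha) _ (hlt hb) hab)
  · obtain ⟨h1, h2, h3, -⟩ := h.adj a ha b hb he
    have h5 := hlt h1
    have h6 := hlt h2
    rw [← hE2 h1 h2] at he
    exact ⟨h1, h2, h3, (h.adj _ (by omega) _ (by omega) he).2.2.2⟩
  · obtain ⟨h1, h2⟩ := h.closed a ha
    have hai : a ≠ i := by rintro rfl; simp_all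
    have haj : a ≠ j := by rintro rfl; simp_all
    have hswap : Equiv.swap i j a = a := Equiv.swap_apply_of_ne_of_ne hai haj
    refine ⟨h1, fun x hx => ?_⟩
    rw [Function.comp_apply, hswap] at hx
    obtain ⟨b, hb, he, hf⟩ := h2 x hx
    refine ⟨Equiv.swap i j b, hlt hb, ?_, by simp [hf]⟩
    rw [← hE2 h1 hb, hswap] at he
    exact he

/-- The names can be chosen such that, among open vertices with the same row, those with the
property `P` come first. The closed vertices and the vertex `w` keep their names. -/
theorem Realizes.exists_canonical (h : Realizes G δ k E c f) (P : V → Prop) (w : ℕ) :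
    ∃ f', Realizes G δ k E c f' ∧ (∀ i, bit c i = true ∨ i = w → f' i = f i) ∧
      (∀ i < k, ∃ j < k, f' j = f i) ∧
      ∀ i j, i < j → j < k → i ≠ w → j ≠ w → bit c i = false → bit c j = false →
        row E i = row E j → P (f' j) → P (f' i) := by
  classical
  -- Choose the names such that the sum of the labels of the vertices with `P` is minimal.
  obtain ⟨n, hn⟩ : ∃ n, n = ∑ j ∈ Finset.range k, if P (f j) then j else 0 := ⟨_, rfl⟩
  induction n using Nat.strong_induction_on generalizing f with
  | _ n ih =>
    by_cases hcan : ∀ i j, i < j → j < k → i ≠ w → j ≠ w → bit c i = false → bit c j = false →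
        row E i = row E j → P (f j) → P (f i)
    · exact ⟨f, h, fun _ _ => rfl, fun i hi => ⟨i, hi, rfl⟩, hcan⟩
    · push Not at hcan
      obtain ⟨i, j, hij, hj, hiw, hjw, hci, hcj, hrow, hPj, hPi⟩ := hcan
      have hi := hij.trans hj
      have hs := h.swap hi hj hci hcj hrow
      have hlt : ∑ a ∈ Finset.range k, (if P ((f ∘ Equiv.swap i j) a) then a else 0) < n := by
        have hre : ∑ a ∈ Finset.range k, (if P ((f ∘ Equiv.swap i j) a) then a else 0) =
            ∑ a ∈ Finset.range k, (if P (f a) then Equiv.swap i j a else 0) := by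
          refine Finset.sum_bijective (Equiv.swap i j) (Equiv.bijective _) (fun a => ?_)
            (fun a _ => by simp)
          simp only [Finset.mem_range]
          rw [Equiv.swap_apply_def]
          split_ifs with h1 h2
          · subst h1; simp [hi, hj]
          · subst h2; simp [hi, hj]
          · rfl
        rw [hre, hn]
        refine Finset.sum_lt_sum (fun a _ => ?_) ⟨j, by simpa using hj, by simp [hPj, hij]⟩
        by_cases ha : a = i
        · subst ha; simp [hPi]
        by_cases ha' : a = j
        · subst ha'; simp [hPj, hij.le]
        · rw [Equiv.swap_apply_of_ne_of_ne ha ha']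
      obtain ⟨f', h1, h2, h3, h4⟩ := ih _ hlt hs rfl
      refine ⟨f', h1, fun a ha => ?_, fun a ha => ?_, h4⟩
      · have hai : a ≠ i := by rintro rfl; simp_all
        have haj : a ≠ j := by rintro rfl; simp_all
        rw [h2 a ha, Function.comp_apply, Equiv.swap_apply_of_ne_of_ne hai haj]
      · have hsa : Equiv.swap i j a < k := by
          rw [Equiv.swap_apply_def]; split_ifs <;> assumption
        obtain ⟨b, hb, hfb⟩ := h3 _ hsa
        exact ⟨b, hb, by simpa using hfb⟩

end Realizes

/-! ### Soundness of the search -/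

section Soundness

variable {V : Type*} [Fintype V] {G : SimpleGraph V} [DecidableRel G.Adj]
  {δ k E c : ℕ} {f : ℕ → V}

/-- The shadow of an edge `uv`: the neighbours of `u` or `v`, and all vertices of positive degree
that become isolated when these are deleted. -/
def shadow (G : SimpleGraph V) (u v : V) : Set V :=
  {x | (∃ y, G.Adj x y) ∧
    ((G.Adj u x ∨ G.Adj v x) ∨ ∀ y, G.Adj x y → G.Adj u y ∨ G.Adj v y)}

/-- The neighbours of two adjacent closed vertices are exactly those listed by `span`. -/
theorem Realizes.adj_or_adj_iff (h : Realizes G δ k E c f) {u v : ℕ} (hu : bit c u = true)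
    (hv : bit c v = true) (y : V) :
    (G.Adj (f u) y ∨ G.Adj (f v) y) ↔ ∃ j < k, bit (span E u v) j = true ∧ f j = y := by
  have hk := h.le
  have huk := (h.closed u hu).1
  have hvk := (h.closed v hv).1
  have hspan : ∀ {j}, j < k → (bit (span E u v) j = true ↔ edge E u j = true ∨ edge E v j = true) :=
    fun hj => bit_span (by omega)
  constructor
  · rintro (hy | hy)
    · obtain ⟨j, hj, he, hf⟩ := (h.closed u hu).2 y hy
      exact ⟨j, hj, (hspan hj).2 (Or.inl he), hf⟩
    · obtain ⟨j, hj, he, hf⟩ := (h.closed v hv).2 y hy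
      exact ⟨j, hj, (hspan hj).2 (Or.inr he), hf⟩
  · rintro ⟨j, hj, hb, rfl⟩
    exact ((hspan hj).1 hb).imp (fun he => (h.adj u (by omega) j (by omega) he).2.2.2)
      (fun he => (h.adj v (by omega) j (by omega) he).2.2.2)

/-- After a suitable renaming, the neighbourhood of the open vertex `v` is described by one of the
branches of `growVertex`. The number `r` of new names is determined by the degree, which for the
initial state leaves only the star with `δ` leaves. -/
theorem Realizes.exists_growVertex (h : Realizes G δ k E c f) {v : ℕ} (hv : v < k)
    (hcv : bit c v = false) (hk : k ≤ 28) (h4 : G.degree (f v) ≤ 4)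
    (hδ : ∀ x y, G.Adj x y → δ ≤ G.degree x) :
    ∃ S ∈ choices E ((List.range k).filter fun j => !(bit c j || edge E v j || Nat.beq j v))
        (4 - (nbrs k E v).length) [],
      ∃ r, (nbrs k E v).length + S.length + r = G.degree (f v) ∧
        (∀ t ∈ S ++ List.range' k r, t < k + r) ∧
        ∃ f', Realizes G δ (k + r) (linkAll E v (S ++ List.range' k r)) (c ||| 2 ^ v) f' := by
  classical
  obtain ⟨f, h1, hfix, -, hcan⟩ := h.exists_canonical (G.Adj (f v)) v
  have hfv := hfix v (Or.inr rfl)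
  rw [← hfv] at hcan h4 ⊢
  clear hfix hfv h
  rename' h1 => h
  set pool := (List.range k).filter fun j => !(bit c j || edge E v j || Nat.beq j v) with hpool
  have hmem : ∀ {j}, j ∈ pool ↔ j < k ∧ bit c j = false ∧ edge E v j = false ∧ j ≠ v := by
    intro j
    have hbeq : Nat.beq j v = false ↔ j ≠ v := by rw [← Bool.not_eq_true, Nat.beq_eq]
    rw [hpool, List.mem_filter, List.mem_range, Bool.not_eq_true', Bool.or_eq_false_iff,
      Bool.or_eq_false_iff, hbeq, and_assoc]
  set S := pool.filter fun j => decide (G.Adj (f v) (f j)) with hS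
  have hmemS : ∀ {j}, j ∈ S ↔ j ∈ pool ∧ G.Adj (f v) (f j) := by
    intro j; simp [hS]
  -- The neighbours that have no name yet.
  set R : Finset V := (G.neighborFinset (f v)).filter fun x => ∀ i < k, f i ≠ x with hR
  have hmemR : ∀ {x}, x ∈ R.toList ↔ G.Adj (f v) x ∧ ∀ i < k, f i ≠ x := by
    intro x; simp [hR]
  have hnamed : ∀ j < k, G.Adj (f v) (f j) → j ∈ nbrs k E v ∨ j ∈ S := by
    intro j hj hadj
    by_cases he : edge E v j = true
    · exact Or.inl (mem_nbrs.2 ⟨hj, he⟩)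
    · refine Or.inr (hmemS.2 ⟨hmem.2 ⟨hj, ?_, by simpa using he, ?_⟩, hadj⟩)
      · by_contra hc
        rw [Bool.not_eq_false] at hc
        have := h.edge_of_adj hc hv hadj.symm
        rw [h.edge_comm (by omega) (by omega)] at this
        exact he this
      · rintro rfl; exact G.loopless.irrefl _ hadj
  have hSnd : S.Nodup := (List.nodup_range.filter _).filter _
  have hnbadj : ∀ j ∈ nbrs k E v, j < k ∧ G.Adj (f v) (f j) :=
    fun j hj => h.adj_of_mem_nbrs (by omega) h.le hj
  have hnd1 : (nbrs k E v ++ S).Nodup := by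
    refine (nodup_nbrs _ _ _).append hSnd fun j hj hj' => ?_
    have := (hmem.1 (hmemS.1 hj').1).2.2.1
    rw [(mem_nbrs.1 hj).2] at this
    exact absurd this (by simp)
  have hle := (h.degree_ge (i := v) _ hnd1
    (fun j hj => (List.mem_append.1 hj).elim (fun hj => (hnbadj j hj).1)
      fun hj => (hmem.1 (hmemS.1 hj).1).1)
    (fun j hj => (List.mem_append.1 hj).elim (fun hj => (hnbadj j hj).2)
      fun hj => (hmemS.1 hj).2)).1
  rw [List.length_append] at hle
  have hRle : R.card ≤ 4 := (Finset.card_le_card (Finset.filter_subset _ _)).trans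
    (by rwa [SimpleGraph.card_neighborFinset_eq_degree])
  have hRlen : R.toList.length = R.card := Finset.length_toList R
  obtain ⟨f', hf', hold, hnew⟩ := h.extend R.toList R.nodup_toList
    (fun i hi hm => (hmemR.1 hm).2 i hi rfl)
    (fun x hx => hδ x _ (hmemR.1 hx).1.symm) (by omega)
  rw [hRlen] at hf'
  have hv' := hold v hv
  have hT : ∀ t ∈ S ++ List.range' k R.card, t < k + R.card ∧ G.Adj (f' v) (f' t) := by
    intro t ht
    rw [hv']
    rcases List.mem_append.1 ht with ht | ht
    · have := (hmem.1 (hmemS.1 ht).1).1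
      rw [hold t this]
      exact ⟨by omega, (hmemS.1 ht).2⟩
    · rw [List.mem_range'_1] at ht
      have := hnew (t - k) (by omega)
      rw [show k + (t - k) = t by omega] at this
      rw [this]
      exact ⟨ht.2, (hmemR.1 (List.getElem_mem _)).1⟩
  have hall : ∀ x, G.Adj (f' v) x → ∃ j ∈ nbrs k E v ++ (S ++ List.range' k R.card), f' j = x := by
    intro x hx
    rw [hv'] at hx
    by_cases hn : ∃ i < k, f i = x
    · obtain ⟨i, hi, rfl⟩ := hn
      refine ⟨i, ?_, hold i hi⟩
      rcases hnamed i hi hx with h | h <;> simp [h]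
    · push Not at hn
      obtain ⟨i, hi, hix⟩ := List.getElem_of_mem (hmemR.2 ⟨hx, hn⟩)
      exact ⟨k + i, by simp; omega, by rw [hnew i hi, hix]⟩
  refine ⟨S, ?_, R.card, ?_, fun t ht => (hT t ht).1, f', ?_⟩
  · refine filter_mem_choices E (fun j => G.Adj (f v) (f j)) pool _ _ ?_ (by simp) ?_
    · change S.length ≤ _
      omega
    · refine List.Pairwise.imp_of_mem ?_ (List.pairwise_lt_range.filter _)
      intro i j hi hj hij hrow hP
      obtain ⟨hi1, hi2, -, hi3⟩ := hmem.1 hi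
      obtain ⟨hj1, hj2, -, hj3⟩ := hmem.1 hj
      exact hcan i j hij hj1 hi3 hj3 hi2 hj2 hrow hP
  · have hnd : (nbrs k E v ++ (S ++ List.range' k R.card)).Nodup := by
      rw [← List.append_assoc]
      refine hnd1.append List.nodup_range' fun j hj hj' => ?_
      rw [List.mem_range'_1] at hj'
      have : j < k := (List.mem_append.1 hj).elim (fun hj => (hnbadj j hj).1)
        fun hj => (hmem.1 (hmemS.1 hj).1).1
      omega
    have := hf'.degree_eq (i := v) _ hnd (fun j hj => ?_) (fun j hj => ?_) hall
    · rw [hv'] at this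
      rw [this]
      simp [add_assoc]
    · rcases List.mem_append.1 hj with hj | hj
      · have := (hnbadj j hj).1
        omega
      · exact (hT j hj).1
    · rcases List.mem_append.1 hj with hj | hj
      · rw [hv', hold j (hnbadj j hj).1]
        exact (hnbadj j hj).2
      · exact (hT j hj).2
  · refine hf'.close (by omega) _ hT fun x hx => ?_
    obtain ⟨j, hj, hjx⟩ := hall x hx
    rcases List.mem_append.1 hj with hj | hj
    · exact ⟨j, by have := (hnbadj j hj).1; omega, Or.inl (mem_nbrs.1 hj).2, hjx⟩
    · exact ⟨j, (hT j hj).1, Or.inr hj, hjx⟩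

/-- If few vertices of the shadow of an edge are known, then one of the branches of `growShadow`
describes a further one. -/
theorem Realizes.exists_growShadow (h : Realizes G δ k E c f) {u v : ℕ} (hu : bit c u = true)
    (hv : bit c v = true) (hdef : deficient k E c u v = true) (hk : k ≤ 28)
    (h4 : ∀ x, G.degree x ≤ 4) (hδ : ∀ x y, G.Adj x y → δ ≤ G.degree x)
    (hbad : ∀ x y, G.Adj x y → 10 ≤ (shadow G x y).ncard) :
    ∃ b ∈ growShadow δ k E c (span E u v), (∀ t ∈ b.2.2, t < b.1) ∧
      ∃ f', Realizes G δ b.1 (linkAll E b.2.1 b.2.2) (c ||| 2 ^ b.2.1) f' := by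
  classical
  have hk32 := h.le
  set a := span E u v with ha
  have huk := (h.closed u hu).1
  have hvk := (h.closed v hv).1
  rw [deficient, Bool.and_eq_true, Nat.ble_eq, ← ha] at hdef
  obtain ⟨huv, hlen⟩ := hdef
  have hadj := (h.adj u (by omega) v (by omega) huv).2.2.2
  obtain ⟨x, hxs, hx⟩ : ∃ x ∈ shadow G (f u) (f v), x ∉
      ((((List.range k).filter (caught E c a)).map f).toFinset : Set V) := by
    by_contra! hcon
    have h1 := Set.ncard_le_ncard (t := (_ : Set V)) hcon (Finset.finite_toSet _)
    rw [Set.ncard_coe_finset] at h1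
    have h2 := List.toFinset_card_le (((List.range k).filter (caught E c a)).map f)
    rw [List.length_map] at h2
    have h3 := hbad _ _ hadj
    omega
  have hx' : ∀ j < k, f j = x → caught E c a j = false := by
    intro j hj hjx
    by_contra hc
    rw [Bool.not_eq_false] at hc
    exact hx (by simpa using ⟨j, ⟨hj, hc⟩, hjx⟩)
  have hN := h.adj_or_adj_iff hu hv
  rw [← ha] at hN
  obtain ⟨⟨y₀, hy₀⟩, hxN⟩ := hxs
  have hxnot : ¬ (G.Adj (f u) x ∨ G.Adj (f v) x) := by
    rw [hN]
    rintro ⟨j, hj, hb, hjx⟩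
    simpa [caught, hb] using hx' j hj hjx
  have hxall := hxN.resolve_left hxnot
  have hbitN : ∀ {j}, j < k → f j = x → bit a j = false := fun hj hjx => by
    rw [← Bool.not_eq_true]
    exact fun hb => hxnot ((hN x).2 ⟨_, hj, hb, hjx⟩)
  -- A name for `x`, the first possible one if `x` is named already.
  obtain ⟨w, hwc, f₁, h₁, hw1, hf1, huf, hvf⟩ : ∃ w ∈ candidates k E c a, ∃ f₁,
      Realizes G δ (max k (w + 1)) E c f₁ ∧ f₁ w = x ∧
      (w < k → bit c w = false) ∧ f₁ u = f u ∧ f₁ v = f v := by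
    by_cases hn : ∃ j < k, f j = x
    · obtain ⟨j₀, hj₀, hj₀x⟩ := hn
      obtain ⟨f₁, h1, hfix, himg, hcan⟩ := h.exists_canonical (· = x) 32
      obtain ⟨w, hw, hwx⟩ := himg j₀ hj₀
      rw [hj₀x] at hwx
      have hopen : bit c w = false ∧ bit a w = false ∧ within (row E w) a = true := by
        have hwnot : bit c w = true → False := by
          intro hc
          rw [hfix w (Or.inl hc)] at hwx
          have hcaught := hx' w hw hwx
          rw [caught, hc, Bool.true_and, Bool.or_eq_false_iff, ← Bool.not_eq_true (within _ _),
            within_iff] at hcaught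
          refine hcaught.2 fun j hj => ?_
          rw [testBit_row, Bool.and_eq_true, decide_eq_true_iff] at hj
          obtain ⟨-, hjk, -, hwj⟩ := h.adj w (by omega) j hj.1 hj.2
          rw [hwx] at hwj
          obtain ⟨i, hi, hb, hij⟩ := (hN _).1 (hxall _ hwj)
          rw [← h.inj i hi j hjk hij, ← bit_eq_testBit]
          exact hb
        have hN₁ := h1.adj_or_adj_iff hu hv
        rw [← ha, hfix u (Or.inl hu), hfix v (Or.inl hv)] at hN₁
        refine ⟨by simpa using hwnot, ?_, ?_⟩
        · rw [← Bool.not_eq_true]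
          intro hb
          exact hxnot ((hN₁ x).2 ⟨w, hw, hb, hwx⟩)
        · rw [within_iff]
          intro j hj
          rw [testBit_row, Bool.and_eq_true, decide_eq_true_iff] at hj
          obtain ⟨-, hjk, -, hwj⟩ := h1.adj w (by omega) j hj.1 hj.2
          rw [hwx] at hwj
          obtain ⟨i, hi, hb, hij⟩ := (hN₁ _).1 (hxall _ hwj)
          rw [← h1.inj i hi j hjk hij, ← bit_eq_testBit]
          exact hb
      refine ⟨w, ?_, f₁, by rwa [max_eq_left hw], hwx, fun _ => hopen.1, hfix u (Or.inl hu),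
        hfix v (Or.inl hv)⟩
      simp only [candidates, List.mem_filter, List.mem_range, Bool.or_eq_true, Bool.and_eq_true,
        hopen, Bool.or_self, Bool.not_false, List.all_eq_true, true_and, and_true]
      refine ⟨by omega, Or.inr fun i hi => ?_⟩
      by_contra hcon
      rw [not_or, Bool.not_eq_true, Bool.not_eq_true, Bool.not_eq_false', Nat.beq_eq] at hcon
      have := hcan i w hi hw (by omega) (by omega) hcon.1 hopen.1 hcon.2 hwx
      have := h1.inj i (by omega) w hw (this.trans hwx.symm)
      omega
    · push Not at hn
      obtain ⟨f₁, h1, hold, hnew⟩ := h.extend [x] (by simp) (by simpa using hn)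
        (by simpa using hδ x _ hy₀) (by simp; omega)
      refine ⟨k, ?_, f₁, by simpa using h1, by simpa using hnew 0 (by simp), fun h => by omega,
        hold u huk, hold v hvk⟩
      rw [candidates, List.mem_filter, List.mem_range, Nat.beq_refl, Bool.true_or]
      exact ⟨by omega, rfl⟩
  have hwle : w ≤ k := by
    rw [candidates, List.mem_filter, List.mem_range] at hwc
    omega
  have hcw : bit c w = false := by
    by_contra hc
    rw [Bool.not_eq_false] at hc
    have := (h.closed w hc).1
    rw [hf1 this] at hc
    exact absurd hc (by simp)
  obtain ⟨f₂, h₂, hfix, -, hcan⟩ := h₁.exists_canonical (G.Adj x) w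
  have hN₂ := h₂.adj_or_adj_iff hu hv
  rw [← ha, hfix u (Or.inl hu), hfix v (Or.inl hv), huf, hvf] at hN₂
  have hw2 : f₂ w = x := (hfix w (Or.inr rfl)).trans hw1
  have hwk : w < max k (w + 1) := by omega
  have hkk : k ≤ max k (w + 1) := le_max_left _ _
  set pool := (List.range k).filter fun j => bit a j && !(bit c j || edge E w j) with hpool
  have hmem : ∀ {j}, j ∈ pool ↔ j < k ∧ bit a j = true ∧ bit c j = false ∧ edge E w j = false := by
    intro j
    rw [hpool, List.mem_filter, List.mem_range, Bool.and_eq_true, Bool.not_eq_true',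
      Bool.or_eq_false_iff]
  set S := pool.filter fun j => decide (G.Adj x (f₂ j)) with hS
  have hmemS : ∀ {j}, j ∈ S ↔ j ∈ pool ∧ G.Adj x (f₂ j) := by
    intro j; simp [hS]
  have hnbadj : ∀ j ∈ nbrs k E w, j < k ∧ G.Adj (f₂ w) (f₂ j) := fun j hj =>
    ⟨(mem_nbrs.1 hj).1, (h₂.adj_of_mem_nbrs (by omega) h.le hj).2⟩
  have hSadj : ∀ j ∈ S, j < k ∧ G.Adj (f₂ w) (f₂ j) := fun j hj =>
    ⟨(hmem.1 (hmemS.1 hj).1).1, hw2 ▸ (hmemS.1 hj).2⟩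
  have hall : ∀ y, G.Adj (f₂ w) y → ∃ j ∈ nbrs k E w ++ S, f₂ j = y := by
    intro y hy
    have hxy := hw2 ▸ hy
    obtain ⟨j, hj, hb, rfl⟩ := (hN₂ y).1 (hxall y hxy)
    have hjk : j < k := by
      rcases (bit_span (by omega)).1 hb with he | he
      · exact (h.adj u (by omega) j (by omega) he).2.1
      · exact (h.adj v (by omega) j (by omega) he).2.1
    refine ⟨j, List.mem_append.2 ?_, rfl⟩
    by_cases he : edge E w j = true
    · exact Or.inl (mem_nbrs.2 ⟨hjk, he⟩)
    · refine Or.inr (hmemS.2 ⟨hmem.2 ⟨hjk, hb, ?_, by simpa using he⟩, hxy⟩)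
      by_contra hc
      rw [Bool.not_eq_false] at hc
      have := h₂.edge_of_adj hc hwk hy.symm
      rw [h₂.edge_comm (by omega) (by omega)] at this
      exact he this
  have hnd : (nbrs k E w ++ S).Nodup := by
    refine (nodup_nbrs _ _ _).append ((List.nodup_range.filter _).filter _) fun j hj hj' => ?_
    have := (hmem.1 (hmemS.1 hj').1).2.2.2
    rw [(mem_nbrs.1 hj).2] at this
    exact absurd this (by simp)
  have happ : ∀ j ∈ nbrs k E w ++ S, j < k ∧ G.Adj (f₂ w) (f₂ j) := fun j hj =>
    (List.mem_append.1 hj).elim (hnbadj j) (hSadj j)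
  have hdeg := h₂.degree_eq _ hnd (fun j hj => (happ j hj).1.trans_le hkk)
    (fun j hj => (happ j hj).2) hall
  rw [List.length_append, hw2] at hdeg
  have hd4 := h4 x
  have hdδ := hδ x _ hy₀
  refine ⟨(max k (w + 1), w, S), ?_, fun t ht => (hSadj t ht).1.trans_le hkk, f₂,
    h₂.close hwk S (fun t ht => ⟨(hSadj t ht).1.trans_le hkk, (hSadj t ht).2⟩) fun y hy => ?_⟩
  · rw [growShadow, List.mem_flatMap]
    refine ⟨w, hwc, List.mem_map.2 ⟨S, List.mem_filter.2 ⟨?_, ?_⟩, rfl⟩⟩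
    · refine filter_mem_choices E (fun j => G.Adj x (f₂ j)) pool _ _ ?_ (by simp) ?_
      · change S.length ≤ _
        omega
      · refine List.Pairwise.imp_of_mem ?_ (List.pairwise_lt_range.filter _)
        intro i j hi hj hij hrow hP
        obtain ⟨hi1, hi2, hi3, -⟩ := hmem.1 hi
        obtain ⟨hj1, hj2, hj3, -⟩ := hmem.1 hj
        have hne : ∀ l < k, bit a l = true → l ≠ w := by
          rintro l hl hb rfl
          exact hxnot ((hN₂ x).2 ⟨l, hwk, hb, hw2⟩)
        exact hcan i j hij (by omega) (hne i hi1 hi2) (hne j hj1 hj2) hi3 hj3 hrow hP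
    · rw [Nat.ble_eq]
      omega
  · obtain ⟨j, hj, hjx⟩ := hall y hy
    refine ⟨j, (happ j hj).1.trans_le hkk, ?_, hjx⟩
    exact (List.mem_append.1 hj).imp (fun hj => (mem_nbrs.1 hj).2) id

/-- Soundness of the search: a state that it refutes does not occur in a graph of maximum degree at
most 4 without `C_5^2` in which every shadow has at least ten vertices. -/
theorem not_realizes_of_refute (h4 : ∀ x, G.degree x ≤ 4)
    (hδ : ∀ x y, G.Adj x y → δ ≤ G.degree x)
    (hbad : ∀ x y, G.Adj x y → 10 ≤ (shadow G x y).ncard)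
    (hfree : blownUpFiveCycle.Free G) (n : ℕ) : ∀ {k E c : ℕ}, refute δ n k E c = true →
      ∀ f, ¬ Realizes G δ k E c f := by
  induction n with
  | zero => intro k E c hr; exact absurd hr (by simp [refute])
  | succ n ih =>
    intro k E c hr f h
    change (Nat.ble k 28 && Option.rec (isBlowUp k E) (fun l => l.all fun b =>
      refute δ n b.1 (linkAll E b.2.1 b.2.2)
        (saturate b.1 (linkAll E b.2.1 b.2.2) (c ||| 2 ^ b.2.1) b.2.2)) (branches δ k E c)) = true
      at hr
    rw [Bool.and_eq_true, Nat.ble_eq] at hr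
    obtain ⟨hk, hr⟩ := hr
    -- It suffices to realize one of the branches.
    have key : ∀ l, branches δ k E c = some l → ¬ ∃ b ∈ l, (∀ t ∈ b.2.2, t < b.1) ∧
        ∃ f', Realizes G δ b.1 (linkAll E b.2.1 b.2.2) (c ||| 2 ^ b.2.1) f' := by
      rintro l hl ⟨b, hb, hT, f', hf'⟩
      rw [hl] at hr
      exact ih (List.all_eq_true.1 hr b hb) f' (hf'.saturate h4 _ hT)
    cases hp : pick k E c with
    | some p =>
      obtain ⟨u, v⟩ := p
      rw [pick] at hp
      obtain ⟨u', hu', hp'⟩ := List.exists_of_findSome?_eq_some hp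
      obtain ⟨v', hv', hp''⟩ := Option.map_eq_some_iff.1 hp'
      obtain ⟨rfl, rfl⟩ := Prod.mk.inj hp''
      have hdef := List.find?_some hv'
      have hmem := List.mem_of_find?_eq_some hv'
      refine key _ (by rw [branches, pick, hp]) (h.exists_growShadow (u := u') (v := v')
        (List.mem_filter.1 hu').2 (List.mem_filter.1 hmem).2 hdef hk h4 hδ hbad)
    | none =>
      cases hv : (List.range k).find? fun v => !bit c v with
      | some v =>
        have hcv := List.find?_some hv
        rw [Bool.not_eq_true'] at hcv
        have hvk := List.mem_range.1 (List.mem_of_find?_eq_some hv)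
        obtain ⟨S, hS, r, hr', hT, f', hf'⟩ := h.exists_growVertex hvk hcv hk (h4 _) hδ
        have := h4 (f v)
        have := h.deg v hvk
        refine key _ (by rw [branches, hp, hv]; rfl)
          ⟨(k + r, v, S ++ List.range' k r), ?_, hT, f', hf'⟩
        rw [growVertex, List.mem_flatMap]
        refine ⟨S, hS, List.mem_map.2
          ⟨r, List.mem_filter.2 ⟨by rw [List.mem_range]; omega, ?_⟩, rfl⟩⟩
        rw [Bool.and_eq_true, Nat.ble_eq, Nat.ble_eq]
        omega
      | none =>
        rw [branches, hp, hv] at hr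
        change isBlowUp k E = true at hr
        rw [isBlowUp, Bool.and_eq_true, Nat.ble_eq] at hr
        obtain ⟨hk10, hr⟩ := hr
        have hlab : ∀ p : Fin 5 × Fin 2,
            blowUpLabels.getD (2 * p.1 + p.2) 0 < 10 := by decide
        have hlinj : ∀ p q : Fin 5 × Fin 2, blowUpLabels.getD (2 * p.1 + p.2) 0 =
            blowUpLabels.getD (2 * q.1 + q.2) 0 → p = q := by decide
        have hstep : ∀ p q : Fin 5 × Fin 2, (q.1 : ℕ) = (p.1 + 1) % 5 →
            G.Adj (f (blowUpLabels.getD (2 * p.1 + p.2) 0))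
              (f (blowUpLabels.getD (2 * q.1 + q.2) 0)) := by
          intro p q hpq
          simp only [List.all_eq_true, List.mem_range] at hr
          have := hr p.1 p.1.2 p.2 p.2.2 q.2 q.2.2
          rw [← hpq] at this
          have h1 := hlab p
          have h2 := hlab q
          exact (h.adj _ (by omega) _ (by omega) this).2.2.2
        have hcyc : ∀ a b : Fin 5, (SimpleGraph.cycleGraph 5).Adj a b →
            (b : ℕ) = (a + 1) % 5 ∨ (a : ℕ) = (b + 1) % 5 := by decide
        refine hfree ⟨⟨⟨fun p => f (blowUpLabels.getD (2 * p.1 + p.2) 0), fun {p q} hpq => ?_⟩,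
          fun p q hpq => hlinj p q (h.inj _ ?_ _ ?_ hpq)⟩⟩
        · rcases hcyc _ _ hpq with h1 | h1
          · exact hstep p q h1
          · exact (hstep q p h1).symm
        · exact (hlab p).trans_le hk10
        · exact (hlab q).trans_le hk10

/-- In a graph of maximum degree at most 4 without a copy of `C_5^2`, some edge has a shadow of at
most nine vertices. -/
theorem exists_ncard_shadow_le (h4 : ∀ x, G.degree x ≤ 4) (hfree : blownUpFiveCycle.Free G)
    (hne : ∃ x y, G.Adj x y) : ∃ x y, G.Adj x y ∧ (shadow G x y).ncard ≤ 9 := by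
  classical
  by_contra! hbad
  -- The search starts at a vertex of minimum positive degree.
  obtain ⟨x₀, hx₀, hmin⟩ := Finset.exists_min_image
    (Finset.univ.filter fun x => ∃ y, G.Adj x y) (fun x => G.degree x)
    (by obtain ⟨x, y, h⟩ := hne; exact ⟨x, by simpa using ⟨y, h⟩⟩)
  simp only [Finset.mem_filter, Finset.mem_univ, true_and] at hx₀ hmin
  obtain ⟨y₀, hy₀⟩ := hx₀
  have hδ : ∀ x y, G.Adj x y → G.degree x₀ ≤ G.degree x := fun x y h => hmin x ⟨y, h⟩
  have h0 : Realizes G (G.degree x₀) 1 0 0 fun _ => x₀ :=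
    ⟨by omega, fun i hi j hj _ => by omega, fun _ _ => le_rfl, fun i _ j _ he => by
      simp [edge, bit] at he, fun i hi => by simp [bit] at hi⟩
  obtain ⟨S, hS, r, hr, hT, f, hf⟩ := h0.exists_growVertex (v := 0) one_pos (by rfl) (by omega)
    (h4 _) hδ
  obtain rfl : S = [] := by
    rw [show ((List.range 1).filter fun j => !(bit 0 j || edge 0 0 j || Nat.beq j 0)) = [] from rfl]
      at hS
    exact List.mem_singleton.1 hS
  obtain rfl : r = G.degree x₀ := by
    rw [← hr, show nbrs 1 0 0 = [] from rfl]
    simp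
  exact not_realizes_of_refute h4 hδ (fun x y h => hbad x y h) hfree 20
    (refute_star (G.degree_pos_iff_exists_adj x₀ |>.2 ⟨y₀, hy₀⟩) (h4 x₀)) f hf

end Soundness

/-! ### From small shadows to induced matchings -/

section Deletion

/-- The graph `G` with all edges deleted that meet `A`. -/
def avoid {V : Type*} (G : SimpleGraph V) (A : Set V) : SimpleGraph V where
  Adj x y := G.Adj x y ∧ x ∉ A ∧ y ∉ A
  symm := ⟨fun _ _ h => ⟨h.1.symm, h.2.2, h.2.1⟩⟩
  loopless := ⟨fun _ h => G.loopless.irrefl _ h.1⟩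

theorem avoid_le {V : Type*} (G : SimpleGraph V) (A : Set V) : avoid G A ≤ G := fun _ _ h => h.1

variable {V : Type*} [Fintype V] {G : SimpleGraph V}

theorem ncard_neighborSet_avoid_le (G : SimpleGraph V) (A : Set V) (x : V) :
    ((avoid G A).neighborSet x).ncard ≤ (G.neighborSet x).ncard :=
  Set.ncard_le_ncard (fun _ h => h.1) (Set.toFinite _)

/-- An edge of `G` can be added to an induced matching that avoids its neighbourhood. -/
theorem strongMatchingNumber_avoid_lt {u v : V} (huv : G.Adj u v) {A : Set V}
    (hA : ∀ x, G.Adj u x ∨ G.Adj v x → x ∈ A) :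
    strongMatchingNumber (avoid G A) + 1 ≤ strongMatchingNumber G := by
  classical
  obtain ⟨M, ⟨hM, hM'⟩, hcard⟩ := (strongMatchingNumber_isGreatest (avoid G A)).1
  refine (strongMatchingNumber_isGreatest G).2 ⟨insert s(u, v) M, ⟨fun e he => ?_, ?_⟩, ?_⟩
  · rcases Finset.mem_insert.1 he with rfl | he
    · exact huv
    · exact SimpleGraph.edgeSet_mono (avoid_le G A) (hM e he)
  · have hout : ∀ e ∈ M, ∀ x ∈ e, x ∉ A := by
      intro e he x hx
      have h1 := hM e he
      rw [← Sym2.other_spec hx] at h1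
      exact ((SimpleGraph.mem_edgeSet _).1 h1).2.1
    have hnew : ∀ x ∈ s(u, v), ∀ y ∉ A, x ≠ y ∧ ¬ G.Adj x y := by
      intro x hx y hy
      rcases Sym2.mem_iff.1 hx with rfl | rfl
      · exact ⟨fun h => hy (h ▸ hA _ (Or.inr huv.symm)), fun h => hy (hA _ (Or.inl h))⟩
      · exact ⟨fun h => hy (h ▸ hA _ (Or.inl huv)), fun h => hy (hA _ (Or.inr h))⟩
    intro e he f hf hef x hx y hy
    rcases Finset.mem_insert.1 he with rfl | he <;> rcases Finset.mem_insert.1 hf with rfl | hf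
    · exact absurd rfl hef
    · exact hnew x hx y (hout f hf y hy)
    · have := hnew y hy x (hout e he x hx)
      exact ⟨this.1.symm, fun h => this.2 h.symm⟩
    · have := hM' e he f hf hef x hx y hy
      exact ⟨this.1, fun h => this.2 ⟨h, hout e he x hx, hout f hf y hy⟩⟩
  · rw [Finset.card_insert_of_notMem, hcard]
    intro h
    exact ((SimpleGraph.mem_edgeSet _).1 (hM _ h)).2.1 (hA _ (Or.inr huv.symm))

theorem degree_eq_ncard (G : SimpleGraph V) [DecidableRel G.Adj] (x : V) :
    G.degree x = (G.neighborSet x).ncard := by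
  rw [← SimpleGraph.card_neighborSet_eq_degree, Set.ncard_eq_toFinset_card', Set.toFinset_card]

theorem ncard_edgeSet_le (h4 : ∀ x, (G.neighborSet x).ncard ≤ 4) :
    G.edgeSet.ncard ≤ 2 * G.support.ncard := by
  classical
  have h1 := G.sum_degrees_eq_twice_card_edges
  have h2 : ∑ x, G.degree x ≤ ∑ x ∈ G.support.toFinset, 4 := by
    rw [← Finset.sum_subset (Finset.subset_univ G.support.toFinset)]
    · exact Finset.sum_le_sum fun x _ => degree_eq_ncard G x ▸ h4 x
    · intro x _ hx
      rw [Set.mem_toFinset, ← SimpleGraph.degree_pos_iff_mem_support] at hx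
      omega
  rw [Finset.sum_const, smul_eq_mul, h1] at h2
  rw [Set.ncard_eq_toFinset_card', Set.ncard_eq_toFinset_card', ← SimpleGraph.edgeFinset]
  omega

/-- In the absence of `C_5^2`, the vertices of positive degree number at most nine times the strong
matching number. -/
theorem ncard_support_le (h4 : ∀ x, (G.neighborSet x).ncard ≤ 4)
    (hfree : blownUpFiveCycle.Free G) : G.support.ncard ≤ 9 * strongMatchingNumber G := by
  classical
  obtain ⟨n, hn⟩ : ∃ n, n = G.support.ncard := ⟨_, rfl⟩
  induction n using Nat.strong_induction_on generalizing G with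
  | _ n ih =>
    by_cases hne : ∃ x y, G.Adj x y
    · obtain ⟨u, v, huv, hs⟩ := exists_ncard_shadow_le (fun x => degree_eq_ncard G x ▸ h4 x)
        hfree hne
      set A : Set V := {x | G.Adj u x ∨ G.Adj v x} with hA
      have hsub : (avoid G A).support ⊆ G.support :=
        SimpleGraph.support_mono (avoid_le G A)
      have hlt : (avoid G A).support.ncard < n := by
        rw [hn]
        refine Set.ncard_lt_ncard (Set.ssubset_iff_exists.2 ⟨hsub, u, ⟨v, huv⟩, ?_⟩)
          (Set.toFinite _)
        rintro ⟨y, hy⟩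
        exact hy.2.1 (Or.inr huv.symm)
      have hcover : G.support ⊆ (avoid G A).support ∪ shadow G u v := by
        rintro x ⟨y, hxy⟩
        by_cases hx : x ∈ shadow G u v
        · exact Or.inr hx
        · left
          simp only [shadow, Set.mem_ofPred_eq, not_and, not_or, not_forall] at hx
          obtain ⟨h1, z, hz, h2⟩ := hx ⟨y, hxy⟩
          exact ⟨z, hz, by simpa [hA] using h1, by simpa [hA] using h2⟩
      have h1 := ih _ hlt (fun x => (ncard_neighborSet_avoid_le G A x).trans (h4 x))
        (fun h => hfree (h.trans (SimpleGraph.IsContained.of_le (avoid_le G A)))) rfl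
      have h2 := strongMatchingNumber_avoid_lt huv (A := A) fun x hx => hx
      have h3 := (Set.ncard_le_ncard hcover (Set.toFinite _)).trans (Set.ncard_union_le _ _)
      omega
    · have : G.support = ∅ := by
        ext x
        simp only [SimpleGraph.mem_support, Set.mem_empty_iff_false, iff_false]
        exact fun ⟨y, h⟩ => hne ⟨x, y, h⟩
      simp [this]

/-- In a graph of maximum degree at most 4, the neighbours of a vertex of a copy of `C_5^2` are its
four neighbours in the copy. -/
theorem exists_adj_of_copy (h4 : ∀ x, (G.neighborSet x).ncard ≤ 4)
    (φ : SimpleGraph.Copy blownUpFiveCycle G) {p : Fin 5 × Fin 2} {y : V} (hy : G.Adj (φ p) y) :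
    ∃ q, blownUpFiveCycle.Adj p q ∧ φ q = y := by
  have hsub : φ '' blownUpFiveCycle.neighborSet p ⊆ G.neighborSet (φ p) := by
    rintro _ ⟨q, hq, rfl⟩
    exact φ.toHom.map_adj hq
  have hcard : (φ '' blownUpFiveCycle.neighborSet p).ncard = 4 := by
    rw [Set.ncard_image_of_injective _ (f := φ) φ.injective]
    have : blownUpFiveCycle.neighborSet p =
        ((Finset.univ.filter fun q : Fin 5 × Fin 2 => (SimpleGraph.cycleGraph 5).Adj p.1 q.1 :
          Finset _) : Set _) := by
      ext q; simp [blownUpFiveCycle]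
    rw [this, Set.ncard_coe_finset]
    clear hsub hy this
    revert p
    decide
  have := Set.eq_of_subset_of_ncard_le hsub (hcard ▸ h4 _) (Set.toFinite _)
  have hy' : y ∈ G.neighborSet (φ p) := hy
  rw [← this] at hy'
  obtain ⟨q, hq, h⟩ := hy'
  exact ⟨q, hq, h⟩

theorem hasBlownUpFiveCycleComponent_of_copy (h4 : ∀ x, (G.neighborSet x).ncard ≤ 4)
    (φ : SimpleGraph.Copy blownUpFiveCycle G) : HasBlownUpFiveCycleComponent G := by
  have hreach : ∀ p, G.Reachable (φ p) (φ (0, 0)) := by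
    have key : ∀ p : Fin 5 × Fin 2, ∃ q : Fin 5 × Fin 2,
        (SimpleGraph.cycleGraph 5).Adj p.1 q.1 ∧
          ((SimpleGraph.cycleGraph 5).Adj q.1 0 ∨ q = (0, 0)) := by decide
    intro p
    obtain ⟨q, h1, h2⟩ := key p
    have h3 : G.Adj (φ p) (φ q) := φ.toHom.map_adj (show blownUpFiveCycle.Adj p q from h1)
    rcases h2 with h2 | rfl
    · have h5 : G.Adj (φ q) (φ (0, 0)) :=
        φ.toHom.map_adj (show blownUpFiveCycle.Adj q (0, 0) from h2)
      exact h3.reachable.trans h5.reachable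
    · exact h3.reachable
  have hclosed : ∀ x y, G.Reachable x y → (∃ p, φ p = x) → ∃ p, φ p = y := by
    rintro x y ⟨w⟩
    induction w with
    | nil => exact id
    | cons h _ ih =>
      rintro ⟨p, rfl⟩
      obtain ⟨q, -, hq⟩ := exists_adj_of_copy h4 φ h
      exact ih ⟨q, hq⟩
  let c := G.connectedComponentMk (φ (0, 0))
  let e : Fin 5 × Fin 2 → c.supp := fun p =>
    ⟨φ p, SimpleGraph.ConnectedComponent.eq.2 (hreach p)⟩
  have he : Function.Bijective e := by
    refine ⟨fun p q h => φ.injective (congrArg Subtype.val h), fun ⟨x, hx⟩ => ?_⟩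
    obtain ⟨p, hp⟩ := hclosed _ _ (SimpleGraph.ConnectedComponent.eq.1 hx).symm ⟨_, rfl⟩
    exact ⟨p, Subtype.ext hp⟩
  refine ⟨c, ⟨SimpleGraph.Iso.symm ⟨Equiv.ofBijective e he, fun {p q} => ?_⟩⟩⟩
  change G.Adj (φ p) (φ q) ↔ _
  refine ⟨fun h => ?_, fun h => φ.toHom.map_adj h⟩
  obtain ⟨q', hq', h'⟩ := exists_adj_of_copy h4 φ h
  rwa [← φ.injective h']

theorem ncard_edgeSet_le_of_free (h4 : ∀ x, (G.neighborSet x).ncard ≤ 4)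
    (hfree : blownUpFiveCycle.Free G) : G.edgeSet.ncard ≤ 18 * strongMatchingNumber G := by
  have h1 := ncard_edgeSet_le h4
  have h2 := ncard_support_le h4 hfree
  omega

/-- Copies of `C_5^2` have 20 edges each and are removed one by one. -/
theorem ncard_edgeSet_le_twenty_mul (h4 : ∀ x, (G.neighborSet x).ncard ≤ 4) :
    G.edgeSet.ncard ≤ 20 * strongMatchingNumber G := by
  obtain ⟨n, hn⟩ : ∃ n, n = G.edgeSet.ncard := ⟨_, rfl⟩
  induction n using Nat.strong_induction_on generalizing G with
  | _ n ih =>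
    by_cases hfree : blownUpFiveCycle.Free G
    · have := ncard_edgeSet_le_of_free h4 hfree
      omega
    · obtain ⟨φ⟩ := SimpleGraph.not_free.1 hfree
      set A : Set V := Set.range φ with hA
      have hclosed : ∀ p x, G.Adj (φ p) x → x ∈ A := by
        intro p x hx
        obtain ⟨q, -, rfl⟩ := exists_adj_of_copy h4 φ hx
        exact ⟨q, rfl⟩
      have huv : G.Adj (φ (0, 0)) (φ (1, 0)) := φ.toHom.map_adj
        (show (SimpleGraph.cycleGraph 5).Adj 0 1 by decide)
      have hν := strongMatchingNumber_avoid_lt huv (A := A)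
        fun x hx => hx.elim (hclosed _ x) (hclosed _ x)
      have hlt : (avoid G A).edgeSet.ncard < n := by
        rw [hn]
        refine Set.ncard_lt_ncard (Set.ssubset_iff_exists.2
          ⟨SimpleGraph.edgeSet_mono (avoid_le G A), s(_, _), huv, fun h => ?_⟩) (Set.toFinite _)
        exact ((SimpleGraph.mem_edgeSet _).1 h).2.1 ⟨_, rfl⟩
      have hcover : G.edgeSet ⊆ (avoid G A).edgeSet ∪ (avoid G Aᶜ).edgeSet := by
        intro e
        induction e using Sym2.ind with
        | _ x y =>
          intro h
          have h : G.Adj x y := h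
          by_cases hx : x ∈ A
          · obtain ⟨p, rfl⟩ := hx
            exact Or.inr ⟨h, fun h' => h' ⟨p, rfl⟩, fun h' => h' (hclosed p _ h)⟩
          · refine Or.inl ⟨h, hx, ?_⟩
            rintro ⟨q, rfl⟩
            exact hx (hclosed q _ h.symm)
      have hsupp : (avoid G Aᶜ).support ⊆ A := by
        rintro x ⟨y, hxy⟩
        exact not_not.1 hxy.2.1
      have hAcard : A.ncard = 10 := by
        rw [hA, ← Set.image_univ, Set.ncard_image_of_injective _ (f := φ) φ.injective,
          Set.ncard_univ]
        simp
      have h1 := ih _ hlt (fun x => (ncard_neighborSet_avoid_le G A x).trans (h4 x)) rfl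
      have h2 := ncard_edgeSet_le fun x => (ncard_neighborSet_avoid_le G Aᶜ x).trans (h4 x)
      have h3 := Set.ncard_le_ncard hsupp (Set.toFinite _)
      have h5 := (Set.ncard_le_ncard hcover (Set.toFinite _)).trans (Set.ncard_union_le _ _)
      omega

end Deletion

end StrongMatching

theorem mainTheorem2 {V : Type*} [Fintype V] [DecidableEq V] (G : SimpleGraph V)
    [DecidableRel G.Adj] (hG : G.maxDegree ≤ 4) :
    (G.edgeFinset.card : ℝ) / 20 ≤ (StrongMatching.strongMatchingNumber G : ℝ) ∧
      (¬ StrongMatching.HasBlownUpFiveCycleComponent G →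
        (G.edgeFinset.card : ℝ) / 18 ≤ (StrongMatching.strongMatchingNumber G : ℝ)) := by
  have h4 : ∀ x, (G.neighborSet x).ncard ≤ 4 := fun x =>
    StrongMatching.degree_eq_ncard G x ▸ (G.degree_le_maxDegree x).trans hG
  have hm : G.edgeFinset.card = G.edgeSet.ncard := by
    rw [Set.ncard_eq_toFinset_card', SimpleGraph.edgeFinset]
  rw [hm]
  refine ⟨?_, fun hno => ?_⟩
  · rw [div_le_iff₀' (by norm_num)]
    exact_mod_cast StrongMatching.ncard_edgeSet_le_twenty_mul h4
  · rw [div_le_iff₀' (by norm_num)]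
    exact_mod_cast StrongMatching.ncard_edgeSet_le_of_free h4 fun ⟨φ⟩ =>
      hno (StrongMatching.hasBlownUpFiveCycleComponent_of_copy h4 φ)
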